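/- Let $R$ be a commutative domain that is $2$-torsionfree ($2r=0$ implies $r=0$ for $r\in R$), let $V$ be an $R$-module and let $\gamma\colon V\times V\to R$ be an $R$-bilinear form. Let $B=B(R,V,\gamma)$ be the inflated algebra of $R$ along $V$: the $R$-module $V\otimes_R V\otimes_R R$ with the $R$-bilinear multiplication determined by $$(a\otimes b\otimes x)(c\otimes d\otimes y)=a\otimes d\otimes x\,\gamma(b,c)\,y\qquad(a,b,c,d\in V,\ x,y\in R),$$ and suppose that $B$ is unital, that is, has a two-sided identity element. Write $\mathcal Z(B)$ for the center of $B$ and $[u,v]=uv-vu$. Let $\mathfrak q\colon B\times B\to B$ be an $R$-bilinear map whose trace $\mathfrak T_{\mathfrak q}(a)=\mathfrak q(a,a)$ is centralizing, that is, $[\mathfrak T_{\mathfrak q}(a),a]\in\mathcal Z(B)$ for all $a\in B$. Then $\mathfrak T_{\mathfrak q}$ is proper: there are an element $z\in\mathcal Z(B)$, an $R$-linear map $\mu\colon B\to\mathcal Z(B)$ and an $R$-bilinear map $\nu_0\colon B\times B\to\mathcal Z(B)$ such that $$\mathfrak T_{\mathfrak q}(a)=z\,a^2+\mu(a)\,a+\nu_0(a,a)\qquad\text{for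 all } a\in B.$$ -/

import Mathlib

open scoped TensorProduct

section Inflated

variable (R A V : Type*) [CommRing R] [Ring A] [Algebra R A] [AddCommGroup V] [Module R V]

/-- The inflated algebra `B(A, V, γ)` of the unital `R`-algebra `A` along the `R`-module `V`, with
respect to an `R`-bilinear form `γ : V × V → A`. As an `R`-module it is `V ⊗ V ⊗ A`; its
multiplication is `(a ⊗ b ⊗ x) (c ⊗ d ⊗ y) = a ⊗ d ⊗ x γ(b, c) y`, see
`InflatedAlgebra.mk_mul_mk`. In general it has no identity element. -/
def InflatedAlgebra (_γ : V →ₗ[R] V →ₗ[R] A) : Type _ := (V ⊗[R] V) ⊗[R] A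

end Inflated

namespace InflatedAlgebra

variable {R A V : Type*} [CommRing R] [Ring A] [Algebra R A] [AddCommGroup V] [Module R V]
variable (γ : V →ₗ[R] V →ₗ[R] A)

instance : AddCommGroup (InflatedAlgebra R A V γ) :=
  inferInstanceAs (AddCommGroup ((V ⊗[R] V) ⊗[R] A))

instance : Module R (InflatedAlgebra R A V γ) :=
  inferInstanceAs (Module R ((V ⊗[R] V) ⊗[R] A))

/-- The pure tensor `a ⊗ b ⊗ x`, as an element of the inflated algebra. -/
def mk (a b : V) (x : A) : InflatedAlgebra R A V γ := (a ⊗ₜ[R] b) ⊗ₜ[R] x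

/-- The action `(a ⊗ b ⊗ x, c) ↦ a ⊗ x γ(b, c)`. -/
noncomputable def left : (V ⊗[R] V) ⊗[R] A →ₗ[R] V →ₗ[R] V ⊗[R] A :=
  TensorProduct.lift (TensorProduct.lift (LinearMap.mk₂ R
    (fun a b => ((LinearMap.mul R A).compl₂ (γ b)).compr₂ (TensorProduct.mk R V A a))
    (by intros; ext; simp)
    (by intros; ext; simp [TensorProduct.smul_tmul'])
    (by intros; ext; simp [mul_add, TensorProduct.tmul_add])
    (by intros; ext; simp)))

/-- The bilinear map `(a ⊗ x, d ⊗ y) ↦ a ⊗ d ⊗ x y`. -/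
noncomputable def glue : V ⊗[R] A →ₗ[R] V ⊗[R] A →ₗ[R] (V ⊗[R] V) ⊗[R] A :=
  (TensorProduct.mk R (V ⊗[R] A) (V ⊗[R] A)).compr₂
    (TensorProduct.map LinearMap.id (LinearMap.mul' R A) ∘ₗ
      (TensorProduct.tensorTensorTensorComm R V A V A).toLinearMap)

/-- The multiplication of the inflated algebra, as a bilinear map. -/
noncomputable def mulMap :
    (V ⊗[R] V) ⊗[R] A →ₗ[R] (V ⊗[R] V) ⊗[R] A →ₗ[R] (V ⊗[R] V) ⊗[R] A where
  toFun s := TensorProduct.lift ((glue (R := R) (A := A) (V := V)) ∘ₗ left γ s) ∘ₗ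
    (TensorProduct.assoc R V V A).toLinearMap
  map_add' s t := by ext; simp
  map_smul' r s := by ext; simp

theorem mulMap_tmul (a b c d : V) (x y : A) :
    mulMap γ ((a ⊗ₜ[R] b) ⊗ₜ[R] x) ((c ⊗ₜ[R] d) ⊗ₜ[R] y) =
      (a ⊗ₜ[R] d) ⊗ₜ[R] (x * γ b c * y) := by
  simp [mulMap, left, glue]

theorem mulMap_assoc (s t u : (V ⊗[R] V) ⊗[R] A) :
    mulMap γ (mulMap γ s t) u = mulMap γ s (mulMap γ t u) := by
  induction s with
  | zero => simp
  | add s₁ s₂ h₁ h₂ => simp [h₁, h₂]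
  | tmul s x =>
  induction s with
  | zero => simp
  | add s₁ s₂ h₁ h₂ => simp [TensorProduct.add_tmul, h₁, h₂]
  | tmul a b =>
  induction t with
  | zero => simp
  | add t₁ t₂ h₁ h₂ => simp [h₁, h₂]
  | tmul t y =>
  induction t with
  | zero => simp
  | add t₁ t₂ h₁ h₂ => simp only [TensorProduct.add_tmul, map_add, LinearMap.add_apply, h₁, h₂]
  | tmul c d =>
  induction u with
  | zero => simp
  | add u₁ u₂ h₁ h₂ => simp [h₁, h₂]
  | tmul u z =>
  induction u with
  | zero => simp
  | add u₁ u₂ h₁ h₂ => simp only [TensorProduct.add_tmul, map_add, h₁, h₂]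
  | tmul e f => simp [mulMap_tmul, mul_assoc]

noncomputable instance : Mul (InflatedAlgebra R A V γ) := ⟨fun s t => mulMap γ s t⟩

/-- The defining formula of the multiplication. -/
theorem mk_mul_mk (a b c d : V) (x y : A) :
    mk γ a b x * mk γ c d y = mk γ a d (x * γ b c * y) :=
  mulMap_tmul γ a b c d x y

noncomputable instance : NonUnitalRing (InflatedAlgebra R A V γ) where
  __ := (inferInstance : AddCommGroup (InflatedAlgebra R A V γ))
  __ := (inferInstance : Mul (InflatedAlgebra R A V γ))
  left_distrib s t u := map_add (mulMap γ s) t u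
  right_distrib s t u := LinearMap.map_add₂ (mulMap γ) s t u
  zero_mul s := LinearMap.map_zero₂ (mulMap γ) s
  mul_zero s := map_zero (mulMap γ s)
  mul_assoc s t u := mulMap_assoc γ s t u

instance : IsScalarTower R (InflatedAlgebra R A V γ) (InflatedAlgebra R A V γ) :=
  ⟨fun r s t => LinearMap.map_smul₂ (mulMap γ) r s t⟩

instance : SMulCommClass R (InflatedAlgebra R A V γ) (InflatedAlgebra R A V γ) :=
  ⟨fun r s t => (map_smul (mulMap γ s) r t).symm⟩

end InflatedAlgebra

section Traces

variable {R B : Type*} [CommRing R] [NonUnitalRing B] [Module R B]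

/-- The trace `a ↦ q(a, a)` of a bilinear map `q`. -/
def bilinearTrace (q : B →ₗ[R] B →ₗ[R] B) (a : B) : B := q a a

/-- A map `T : B → B` is centralizing if `[T(a), a]` is central for all `a`. -/
def IsCentralizing (T : B → B) : Prop :=
  ∀ a : B, T a * a - a * T a ∈ Set.center B

variable (R) in
/-- A map `T : B → B` (the trace of a bilinear map) is proper if
`T(a) = z a² + μ(a) a + ν(a)` with `z` central, `μ` a linear map into the center, and `ν` the trace
of a bilinear map into the center. -/
def IsProperBilinearTrace [IsScalarTower R B B] [SMulCommClass R B B] (T : B → B) : Prop :=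
  ∃ (z : NonUnitalSubalgebra.center R B) (μ : B →ₗ[R] NonUnitalSubalgebra.center R B)
    (ν : B →ₗ[R] B →ₗ[R] NonUnitalSubalgebra.center R B),
    ∀ a : B, T a = (z : B) * (a * a) + (μ a : B) * a + (ν a a : B)

end Traces

/-! Write the identity as `e = ∑ aᵢ ⊗ bᵢ ⊗ 1` with Gram matrix `P`. After a change of the `aᵢ`, `P`
is idempotent and `B` is the corner `P Mₙ(R) P`, which is locally a full matrix ring
(`cornerPresentation`). Localisation is made explicit: for a set `J` of indices let `s_J` be the
determinant of the matrix with rows from `P` over `J` and from `1 - P` elsewhere. Up to powers of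
`s_J`, `B` is the ring of `J × J` matrices (`exists_matrixFrame`), and `∑ s_J = 1`. Over a domain
the matrix case is `Matrix.proper_of_centralizing`. It only uses that the off-diagonal entries of
`[q(X, X), X]` vanish. With at least three indices, polarisation at matrix units determines the
off-diagonal entries of `q(X, X)`; with two, a divisibility argument does; the diagonal then
follows. Hence `s_J ^ 8 • q(a, a)` is proper for every `J`. The scalars `r` for which `r • q(a, a)`
is proper form an ideal, so this ideal contains `1`. -/

/-! ### Commuting relations at matrix units, at least three indices -/

/-- The `(p, q)` entries, `p ≠ q`, of `∑ [S(a, b), c] = 0` (cyclic sum) at matrix units, in terms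
of the coordinates `S i j k l p m` of a symmetric bilinear map on matrices. -/
structure IsCommutingFamily {ι R : Type*} [DecidableEq ι] [CommRing R]
    (S : ι → ι → ι → ι → ι → ι → R) : Prop where
  symm : ∀ i j k l p m, S i j k l p m = S k l i j p m
  rel : ∀ i j k l m n p q, p ≠ q →
    (if n = q then S i j k l p m else 0) - (if p = m then S i j k l n q else 0) +
    (if j = q then S k l m n p i else 0) - (if p = i then S k l m n j q else 0) +
    (if l = q then S m n i j p k else 0) - (if p = k then S m n i j l q else 0) = 0

namespace IsCommutingFamily

variable {ι R : Type*} [DecidableEq ι] [CommRing R] {S : ι → ι → ι → ι → ι → ι → R}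

theorem transpose (hS : IsCommutingFamily S) :
    IsCommutingFamily (fun i j k l p m => S j i l k m p) where
  symm i j k l p m := hS.symm ..
  rel i j k l m n p q hpq := by
    have h := hS.rel j i l k n m q p hpq.symm
    simp only [eq_comm (a := q), eq_comm (b := p)] at h ⊢
    linear_combination -h

/-- Bracketing with `E_mq` and reading entry `(p, q)` isolates the coefficient if `q` avoids `j`,
`l`, `p`. If no such `q` exists, the index set is `{j, l, p}` and `i, k, m` lie in `{j, l}`. Two of
them then coincide, and the antisymmetries `e1`, `e2` give twice the coefficient `= 0`. -/
theorem eq_zero_of_row (h2 : ∀ r : R, 2 * r = 0 → r = 0)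
    (h3 : ∀ x y : ι, ∃ w, w ≠ x ∧ w ≠ y) (hS : IsCommutingFamily S) {i j k l p m : ι}
    (hm : p ≠ m) (hi : p ≠ i) (hk : p ≠ k) : S i j k l p m = 0 := by
  by_cases hq : ∃ q, q ≠ j ∧ q ≠ l ∧ q ≠ p
  · obtain ⟨q, hj, hl, hp⟩ := hq
    have h := hS.rel i j k l m q p q hp.symm
    grind
  · push Not at hq
    obtain ⟨q, hj, hl⟩ := h3 j l
    have hqp := hq q hj hl
    have hjl : j ≠ l := by
      rintro rfl
      obtain ⟨w, hw, hw'⟩ := h3 j p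
      exact hw' (hq w hw hw)
    have e1 : ∀ i k m, p ≠ i → p ≠ k → p ≠ m → S i j k l p m = - S m j k l p i := by
      intro i k m hi hk hm
      have h := hS.rel i j k l m j p j (by grind)
      have := hS.symm k l m j p i
      grind
    have e2 : ∀ i k m, p ≠ i → p ≠ k → p ≠ m → S i j k l p m = - S i j m l p k := by
      intro i k m hi hk hm
      have h := hS.rel i j k l m l p l (by grind)
      have := hS.symm m l i j p k
      grind
    have d1 : ∀ i k, p ≠ i → p ≠ k → S i j k l p i = 0 := fun i k hi hk =>
      h2 _ (by linear_combination e1 i k i hi hk hi)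
    have d2 : ∀ i k, p ≠ i → p ≠ k → S i j k l p k = 0 := fun i k hi hk =>
      h2 _ (by linear_combination e2 i k k hi hk hk)
    have hmem : ∀ a, p ≠ a → a = j ∨ a = l := fun a ha => by
      by_contra! hc
      exact ha (hq a hc.1 hc.2).symm
    have := hmem i hi; have := hmem k hk; have := hmem m hm
    by_cases him : i = m
    · subst him; exact d1 _ _ hi hk
    by_cases hkm : k = m
    · subst hkm; exact d2 _ _ hi hk
    have hik : i = k := by grind
    subst hik
    rw [e2 _ _ _ hi hi hm, d1 _ _ hi hm, neg_zero]

theorem eq_zero_of_col (h2 : ∀ r : R, 2 * r = 0 → r = 0)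
    (h3 : ∀ x y : ι, ∃ w, w ≠ x ∧ w ≠ y) (hS : IsCommutingFamily S) {i j k l p m : ι}
    (hm : p ≠ m) (hi : m ≠ j) (hk : m ≠ l) : S i j k l p m = 0 :=
  hS.transpose.eq_zero_of_row h2 h3 (i := j) (j := i) (k := l) (l := k) hm.symm hi hk

theorem eq_zero_of_cross (h2 : ∀ r : R, 2 * r = 0 → r = 0)
    (h3 : ∀ x y : ι, ∃ w, w ≠ x ∧ w ≠ y) (hS : IsCommutingFamily S) {i j k l : ι} (hil : i ≠ l) (hik : i ≠ k)
    (hjk : j ≠ k) (hjl : j ≠ l) : S i j k l i l = 0 := by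
  by_cases hkl : k = l
  · subst hkl
    have h := hS.rel i j k k k k i k hil
    have h0 := hS.eq_zero_of_row h2 h3 (i := k) (j := k) (k := k) (l := k) hjl hjl hjl
    have := hS.symm i j k k i k
    apply h2
    grind
  · have h := hS.rel i j k l l k i k hik
    have h0 := hS.eq_zero_of_row h2 h3 (i := k) (j := l) (k := l) (l := k) hjk hjk hjl
    grind

/-- The coefficient of `E_ij` in `S(E_ij, E_kl)` does not change along paths. -/
theorem step (hS : IsCommutingFamily S) {i j q k l : ι} (hij : i ≠ j) (hjq : j ≠ q) (hiq : i ≠ q)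
    (hik : i ≠ k) (hql : q ≠ l) : S i j k l i j = S j q k l j q := by
  have h := hS.rel i j k l j q i q hiq
  have := hS.symm k l j q j q
  grind

theorem two_mul_coeff (hS : IsCommutingFamily S) {i j l : ι} (hij : i ≠ j) (hjl : j ≠ l)
    (hil : i ≠ l) : S j l j l j l = 2 * S i j j l i j := by
  have h := hS.rel i j j l j l i l hil
  have := hS.symm i j j l i j
  grind

theorem flip (h2 : ∀ r : R, 2 * r = 0 → r = 0)
    (h3 : ∀ x y : ι, ∃ w, w ≠ x ∧ w ≠ y) (hS : IsCommutingFamily S) {i j k l : ι} (hij : i ≠ j) (hkl : k ≠ l)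
    (h1 : ¬ (k = i ∧ l = j)) (h1' : ¬ (k = j ∧ l = i)) : S i j k l i j = S j i k l j i := by
  have h := hS.rel i j k l j j i j hij
  have h' := hS.rel j i k l j j j i hij.symm
  have a1 : i ≠ k → l = j → S j j i j i k = 0 := fun a b =>
    hS.eq_zero_of_col h2 h3 a (by grind) (by grind)
  have a2 : l ≠ j → i = k → S j j i j l j = 0 := fun a b =>
    hS.eq_zero_of_row h2 h3 a (by grind) (by grind)
  have a3 : l = i → j ≠ k → S j j j i j k = 0 := fun a b =>
    hS.eq_zero_of_col h2 h3 b (by grind) (by grind)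
  have a4 : l ≠ i → j = k → S j j j i l i = 0 := fun a b =>
    hS.eq_zero_of_row h2 h3 a (by grind) (by grind)
  grind

theorem flip_diag (h2 : ∀ r : R, 2 * r = 0 → r = 0) (hS : IsCommutingFamily S) {i j k : ι} (hij : i ≠ j) :
    S i j k k i j = S j i k k j i := by
  have key : ∀ i j, i ≠ j → k ≠ i → S i j k k i j = S j i k k j i := by
    intro i j hij hki
    have h := hS.rel i j k k j j i j hij
    have h' := hS.rel j i k k j j j i hij.symm
    by_cases hkj : k = j
    · subst hkj
      have := hS.symm k k i k i k
      have := hS.symm k k k i k i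
      refine sub_eq_zero.1 (h2 _ ?_)
      grind
    · grind
  by_cases hki : k = i
  · exact (key j i hij.symm (by grind)).symm
  · exact key i j hij hki

/-- In the expected form this reads `z = (z + μ(E_ll)) - μ(E_ll)`; `coeff_diag_source` is the
analogue with `E_ii`. -/
theorem coeff_diag_target (hS : IsCommutingFamily S) {i j l : ι} (hij : i ≠ j) (hjl : j ≠ l)
    (hil : i ≠ l) : S i j j l i l = S j l l l j l - S i j l l i j := by
  have h := hS.rel i j l l j l i l hil
  have := hS.symm j l l l j l
  have := hS.symm j l i j i l
  grind

theorem coeff_diag_source (hS : IsCommutingFamily S) {i j l : ι} (hij : i ≠ j) (hjl : j ≠ l)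
    (hil : i ≠ l) : S i j j l i l = S i j i i i j - S j l i i j l := by
  have h := hS.rel i j i i j l i l hil
  have := hS.symm i i j l j l
  have := hS.symm j l i j i l
  grind

theorem swap_left (h2 : ∀ r : R, 2 * r = 0 → r = 0) (hS : IsCommutingFamily S) {i j l : ι}
    (hij : i ≠ j) (hjl : j ≠ l) (hil : i ≠ l) : S i j j l i l = S j i i l j l := by
  rw [hS.coeff_diag_target hij hjl hil, hS.coeff_diag_target hij.symm hil hjl,
    hS.flip_diag h2 hij, hS.step hjl hil.symm hij.symm hjl hil, hS.flip_diag h2 hil.symm]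

theorem swap_right (h2 : ∀ r : R, 2 * r = 0 → r = 0) (hS : IsCommutingFamily S) {i j l : ι}
    (hij : i ≠ j) (hjl : j ≠ l) (hil : i ≠ l) : S i j j l i l = S i l l j i j := by
  rw [hS.coeff_diag_source hij hjl hil, hS.coeff_diag_source hil hjl.symm hij,
    hS.flip_diag h2 hij, hS.step hij.symm hil hjl hij.symm hil.symm, hS.flip_diag h2 hjl]

theorem shift (hS : IsCommutingFamily S) {i j l q : ι} (hij : i ≠ j) (hil : i ≠ l)
    (hqi : q ≠ i) (hqj : q ≠ j) (hql : q ≠ l) : S i j j l i l = S j l l q j q := by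
  have h := hS.rel i j j l l q i q hqi.symm
  grind

theorem replace (h2 : ∀ r : R, 2 * r = 0 → r = 0) (hS : IsCommutingFamily S) {i i' j l : ι}
    (hij : i ≠ j) (hjl : j ≠ l) (hil : i ≠ l) (hij' : i' ≠ j) (hil' : i' ≠ l) :
    S i j j l i l = S i' j j l i' l := by
  by_cases h : i' = i
  · rw [h]
  · rw [hS.shift hij hil h hij' hil', hS.swap_right h2 hjl hil'.symm hij'.symm,
      hS.swap_left h2 hij'.symm hil' hjl]

/-- The coefficient is a function of the ordered triple `(i, j, l)`. `swap_left` and `swap_right`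
permute the triple, `replace` changes one index, and these moves connect any two triples of distinct
indices. -/
theorem product_coeff_eq (h2 : ∀ r : R, 2 * r = 0 → r = 0) (hS : IsCommutingFamily S)
    {i j l x y w : ι} (hij : i ≠ j) (hjl : j ≠ l) (hil : i ≠ l)
    (hxy : x ≠ y) (hyw : y ≠ w) (hxw : x ≠ w) : S i j j l i l = S x y y w x w := by
  have first : ∀ i j l, i ≠ j → j ≠ l → i ≠ l → ∃ b c, x ≠ b ∧ b ≠ c ∧ x ≠ c ∧
      S i j j l i l = S x b b c x c := by
    intro i j l hij hjl hil
    by_cases hxj : x = j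
    · exact ⟨i, l, by grind, hil, by grind, by rw [hxj]; exact hS.swap_left h2 hij hjl hil⟩
    by_cases hxl : x = l
    · refine ⟨i, j, by grind, hij, by grind, ?_⟩
      rw [hxl, hS.swap_right h2 hij hjl hil, hS.swap_left h2 hil hjl.symm hij]
    · exact ⟨j, l, hxj, hjl, hxl, hS.replace h2 hij hjl hil hxj hxl⟩
  obtain ⟨b, c, hxb, hbc, hxc, e⟩ := first i j l hij hjl hil
  have second : ∀ b c, x ≠ b → b ≠ c → x ≠ c → ∃ c', x ≠ c' ∧ y ≠ c' ∧
      S x b b c x c = S x y y c' x c' := by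
    intro b c hxb hbc hxc
    by_cases hyc : y = c
    · exact ⟨b, hxb, by grind, by rw [hyc]; exact hS.swap_right h2 hxb hbc hxc⟩
    · refine ⟨c, hxc, hyc, ?_⟩
      rw [hS.swap_left h2 hxb hbc hxc, hS.replace h2 hxb.symm hxc hbc hxy.symm hyc,
        hS.swap_left h2 hxy.symm hxc hyc]
  obtain ⟨c', hxc', hyc', e'⟩ := second b c hxb hbc hxc
  rw [e, e', hS.swap_right h2 hxy hyc' hxc', hS.swap_left h2 hxc' hyc'.symm hxy,
    hS.replace h2 hxc'.symm hxy hyc'.symm hxw.symm hyw.symm, hS.swap_left h2 hxw.symm hxy hyw.symm,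
    hS.swap_right h2 hxw hyw.symm hxy]

theorem exists_coeffs (h2 : ∀ r : R, 2 * r = 0 → r = 0)
    (h3 : ∀ x y : ι, ∃ w, w ≠ x ∧ w ≠ y) (hS : IsCommutingFamily S) :
    ∃ (z : R) (μ : ι → ι → R), ∀ i j k l p m, p ≠ m → S i j k l p m =
      z * ((if j = k ∧ p = i ∧ m = l then 1 else 0) + (if l = i ∧ p = k ∧ m = j then 1 else 0)) +
      (if k = p ∧ l = m then μ i j else 0) + (if i = p ∧ j = m then μ k l else 0) := by
  obtain hι | ⟨⟨x⟩⟩ := isEmpty_or_nonempty ι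
  · exact ⟨0, 0, fun i => (hι.false i).elim⟩
  obtain ⟨y, hyx, -⟩ := h3 x x
  obtain ⟨w, hwx, hwy⟩ := h3 x y
  choose f hf using fun k : ι => h3 k k
  set z := S x y y w x w with hz
  have Z : ∀ i j l, i ≠ j → j ≠ l → i ≠ l → S i j j l i l = z := fun i j l hij hjl hil =>
    hS.product_coeff_eq h2 hij hjl hil hyx.symm hwy.symm hwx.symm
  -- the coefficients of the diagonal matrix units
  have D1 : ∀ i k, i ≠ k → S i k k k i k = S (f k) k k k (f k) k := by
    intro i k hik
    by_cases h : i = f k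
    · rw [← h]
    · rw [hS.step hik (hf k).1.symm h hik (hf k).1, hS.flip_diag h2 (hf k).1.symm]
  have D2 : ∀ i j k, i ≠ j → i ≠ k → j ≠ k → S i j k k i j = S (f k) k k k (f k) k - z := by
    intro i j k hij hik hjk
    have := hS.coeff_diag_target hij hjk hik
    rw [← D1 j k hjk, ← Z i j k hij hjk hik, this]
    ring
  -- the coefficients of the other matrix units
  have F : ∀ i j k l, i ≠ j → k ≠ l → ¬ (i = k ∧ j = l) → S i j k l i j = S l k k l l k := by
    have Fkq : ∀ k l q, k ≠ l → q ≠ k → q ≠ l → S k q k l k q = S l k k l l k := by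
      intro k l q hkl hqk hql
      exact (hS.step hkl.symm hqk.symm hql.symm hkl.symm hql).symm
    have Fil : ∀ k l i, k ≠ l → i ≠ k → i ≠ l → S i l k l i l = S l k k l l k := by
      intro k l i hkl hik hil
      exact hS.step hil hkl.symm hik hik hkl
    intro i j k l hij hkl hne
    by_cases hik : i = k
    · subst hik
      exact Fkq i l j hkl hij.symm (by grind)
    by_cases hjl : j = l
    · subst hjl
      exact Fil k j i hkl hik hij
    by_cases hjk : j = k
    · subst hjk
      by_cases hil : i = l
      · rw [hil]
      · rw [hS.flip h2 h3 hij hkl (by grind) (by grind)]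
        exact Fkq j l i hkl hij hil
    by_cases hil : i = l
    · subst hil
      rw [hS.flip h2 h3 hij hkl (by grind) (by grind)]
      exact Fil k i j hkl hjk hjl
    · rw [hS.step hij hjk hik hik hkl, hS.flip h2 h3 hjk hkl (by grind) (by grind)]
      exact Fkq k l j hkl hjk hjl
  have F2 : ∀ k l, k ≠ l → S k l k l k l = 2 * S l k k l l k := by
    intro k l hkl
    obtain ⟨i, hik, hil⟩ := h3 k l
    rw [hS.two_mul_coeff hik hkl hil, F i k k l hik hkl (by grind)]
  -- Forced values: `E_lk E_kl` and `E_kl E_lk` are diagonal, so the `(l, k)` entry is `μ(E_kl)`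
  -- alone, while `E_(f k)k E_kk = E_(f k)k` contributes `z + μ(E_kk)`.
  refine ⟨z, fun k l => if k = l then S (f k) k k k (f k) k - z else S l k k l l k, ?_⟩
  have C : ∀ i j k l, i ≠ j → S i j k l i j =
      z * ((if j = k ∧ j = l then 1 else 0) + (if l = i ∧ i = k then 1 else 0)) +
      (if k = i ∧ l = j then S j i i j j i else 0) +
        (if k = l then S (f k) k k k (f k) k - z else S l k k l l k) := by
    intro i j k l hij
    by_cases hkl : k = l
    · subst hkl
      by_cases hjk : j = k
      · have := D1 i j hij
        grind
      by_cases hik : i = k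
      · have := D1 j i hij.symm
        have := hS.flip_diag h2 (k := k) hij
        grind
      · have := D2 i j k hij hik hjk
        grind
    · by_cases hc : i = k ∧ j = l
      · obtain ⟨rfl, rfl⟩ := hc
        have := F2 i j hij
        grind
      · have := F i j k l hij hkl hc
        grind
  intro i j k l p m hpm
  -- The row and column lemmas leave the positions `(i, j)` and `(k, l)`, treated by `C`, and `(i,
  -- l)` and `(k, j)`, treated by `cross`.
  by_cases hp : p ≠ i ∧ p ≠ k
  · have := hS.eq_zero_of_row h2 h3 (j := j) (l := l) hpm hp.1 hp.2
    grind
  by_cases hm : m ≠ j ∧ m ≠ l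
  · have := hS.eq_zero_of_col h2 h3 (i := i) (k := k) hpm hm.1 hm.2
    grind
  by_cases h1 : p = i ∧ m = j
  · obtain ⟨rfl, rfl⟩ := h1
    have := C p m k l hpm
    grind
  by_cases h1' : p = k ∧ m = l
  · obtain ⟨rfl, rfl⟩ := h1'
    have := C p m i j hpm
    have := hS.symm i j p m p m
    grind
  have cross : ∀ i j k l, i ≠ l → i ≠ k → j ≠ l → S i j k l i l = if j = k then z else 0 := by
    intro i j k l hil hik hjl
    by_cases hjk : j = k
    · subst hjk
      simpa using Z i j l hik hjl hil
    · simpa [hjk] using hS.eq_zero_of_cross h2 h3 hil hik hjk hjl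
  by_cases hpi : p = i
  · have := cross i j k l
    grind
  · have := cross k l i j
    have := hS.symm i j k l p m
    grind

end IsCommutingFamily

/-! ### Centralizing traces on matrix rings -/

/-- A quadratic form whose product with a linear form vanishes is zero. -/
theorem LinearMap.apply_self_eq_zero_of_mul {R M : Type*} [CommRing R] [IsDomain R]
    (h2 : ∀ r : R, 2 * r = 0 → r = 0) [AddCommGroup M] [Module R M]
    (f : M →ₗ[R] M →ₗ[R] R) (l : M →ₗ[R] R) {x₀ : M} (hx₀ : l x₀ ≠ 0)
    (h : ∀ x, f x x * l x = 0) (x : M) : f x x = 0 := by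
  by_cases hx : l x = 0
  -- The form vanishes at `x₀` and `x ± x₀`, where `l` is nonzero; the parallelogram law gives `2
  -- f(x, x) = 0`.
  · have h₀ : f x₀ x₀ = 0 := (mul_eq_zero.1 (h x₀)).resolve_right hx₀
    have h₁ := (mul_eq_zero.1 (h (x + x₀))).resolve_right (by simpa [hx])
    have h₂ := (mul_eq_zero.1 (h (x - x₀))).resolve_right (by simpa [hx])
    simp only [map_add, map_sub, LinearMap.add_apply, LinearMap.sub_apply] at h₁ h₂
    apply h2
    linear_combination h₁ + h₂ - 2 * h₀
  · exact (mul_eq_zero.1 (h x)).resolve_right hx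

namespace Matrix

section

variable {ι R : Type*} [CommRing R]

/-- The `(p, r)` entry of a bilinear map with matrix values. -/
def entryForm (q : Matrix ι ι R →ₗ[R] Matrix ι ι R →ₗ[R] Matrix ι ι R) (p r : ι) :
    Matrix ι ι R →ₗ[R] Matrix ι ι R →ₗ[R] R :=
  q.compr₂ (entryLinearMap R R p r)

@[simp]
theorem entryForm_apply (q : Matrix ι ι R →ₗ[R] Matrix ι ι R →ₗ[R] Matrix ι ι R) (p r : ι)
    (X Y : Matrix ι ι R) : entryForm q p r X Y = q X Y p r := rfl

end

variable {ι R : Type*} [Fintype ι] [DecidableEq ι] [CommRing R]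

/-- The standard proper bilinear map `(X, Y) ↦ z X Y + μ(X) Y`. -/
def properForm (z : R) (μ : Matrix ι ι R →ₗ[R] R) :
    Matrix ι ι R →ₗ[R] Matrix ι ι R →ₗ[R] Matrix ι ι R :=
  z • LinearMap.mul R (Matrix ι ι R) + (LinearMap.lsmul R (Matrix ι ι R)) ∘ₗ μ

@[simp]
theorem properForm_apply (z : R) (μ : Matrix ι ι R →ₗ[R] R) (X Y : Matrix ι ι R) :
    properForm z μ X Y = z • (X * Y) + μ X • Y := rfl

/-- The remainder `d(X, X)` is diagonal and has the same commutator with `X` as `q(X, X)`. So `(d_pp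
- d_rr) X_pr = 0`, which forces all diagonal entries to agree. -/
theorem proper_of_offDiag [IsDomain R] (h2 : ∀ r : R, 2 * r = 0 → r = 0)
    (q : Matrix ι ι R →ₗ[R] Matrix ι ι R →ₗ[R] Matrix ι ι R)
    (hq : ∀ X p r, p ≠ r → (q X X * X - X * q X X) p r = 0)
    (z : R) (μ : Matrix ι ι R →ₗ[R] R)
    (h : ∀ X p r, p ≠ r → (q X X - z • (X * X) - μ X • X) p r = 0) :
    ∃ ν : Matrix ι ι R →ₗ[R] Matrix ι ι R →ₗ[R] R,
      ∀ X, q X X = z • (X * X) + μ X • X + ν X X • (1 : Matrix ι ι R) := by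
  set d := q - properForm z μ with hd
  have hdX : ∀ X, d X X = q X X - z • (X * X) - μ X • X := fun X => by simp [hd, sub_sub]
  have hoff : ∀ X p r, p ≠ r → d X X p r = 0 := fun X p r hpr => by rw [hdX]; exact h X p r hpr
  have hcomm : ∀ X, d X X * X - X * d X X = q X X * X - X * q X X := fun X => by
    rw [hdX]
    simp only [sub_mul, mul_sub, smul_mul_assoc, mul_smul_comm, mul_assoc]
    abel
  have hdiag : ∀ X, ∃ t : ι → R, d X X = diagonal t := fun X =>
    ⟨fun i => d X X i i, by
      ext p r
      by_cases hpr : p = r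
      · simp [hpr]
      · simp [hpr, hoff X p r hpr]⟩
  have heq : ∀ X p r, d X X p p = d X X r r := by
    intro X p r
    by_cases hpr : p = r
    · rw [hpr]
    have := LinearMap.apply_self_eq_zero_of_mul h2 (entryForm d p p - entryForm d r r)
      (entryLinearMap R R p r) (x₀ := single p r 1) (by simp) (fun Y => by
        have hY := hq Y p r hpr
        rw [← hcomm] at hY
        obtain ⟨t, ht⟩ := hdiag Y
        simp only [LinearMap.sub_apply, entryForm_apply, entryLinearMap_apply]
        rw [ht] at hY ⊢
        simp only [sub_apply, diagonal_mul, mul_diagonal, diagonal_apply_eq] at hY ⊢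
        linear_combination hY) X
    simpa [sub_eq_zero] using this
  obtain hι | ⟨⟨i₀⟩⟩ := isEmpty_or_nonempty ι
  · exact ⟨0, fun X => Subsingleton.elim _ _⟩
  refine ⟨entryForm d i₀ i₀, fun X => ?_⟩
  have : d X X = d X X i₀ i₀ • (1 : Matrix ι ι R) := by
    ext p r
    by_cases hpr : p = r
    · subst hpr; simp [heq X p i₀]
    · simp [hpr, hoff X p r hpr]
  rw [entryForm_apply, ← this, hdX]
  abel

theorem isCommutingFamily_of_offDiag
    (q : Matrix ι ι R →ₗ[R] Matrix ι ι R →ₗ[R] Matrix ι ι R)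
    (hq : ∀ X p r, p ≠ r → (q X X * X - X * q X X) p r = 0) :
    IsCommutingFamily (fun i j k l p m =>
      (q (single i j 1) (single k l 1) + q (single k l 1) (single i j 1)) p m) where
  symm i j k l p m := by rw [add_comm]
  rel i j k l m n p r hpr := by
    set a := single i j (1 : R)
    set b := single k l (1 : R)
    set c := single m n (1 : R)
    have key : ((q a b + q b a) * c - c * (q a b + q b a) + ((q b c + q c b) * a
        - a * (q b c + q c b)) + ((q c a + q a c) * b - b * (q c a + q a c))) p r = 0 := by
      have e := hq (a + b + c) p r hpr
      have e₁ := hq (a + b) p r hpr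
      have e₂ := hq (b + c) p r hpr
      have e₃ := hq (a + c) p r hpr
      have f₁ := hq a p r hpr
      have f₂ := hq b p r hpr
      have f₃ := hq c p r hpr
      simp only [map_add, LinearMap.add_apply, add_mul, mul_add, add_apply, sub_apply] at *
      linear_combination e - e₁ - e₂ - e₃ + f₁ + f₂ + f₃
    have hr : ∀ (X : Matrix ι ι R) (u v : ι), (X * single u v (1 : R)) p r =
        if v = r then X p u else 0 := by
      intro X u v
      split_ifs with h
      · subst h; simp
      · exact mul_single_apply_of_ne _ _ _ _ _ (Ne.symm h) _
    have hl : ∀ (X : Matrix ι ι R) (u v : ι), (single u v (1 : R) * X) p r =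
        if p = u then X v r else 0 := by
      intro X u v
      split_ifs with h
      · subst h; simp
      · exact single_mul_apply_of_ne _ _ _ _ _ h _
    rw [add_apply, add_apply, sub_apply, sub_apply, sub_apply, hr, hr, hr, hl, hl, hl] at key
    linear_combination key

theorem exists_offDiag_of_three (h2 : ∀ r : R, 2 * r = 0 → r = 0)
    (h3 : ∀ x y : ι, ∃ w, w ≠ x ∧ w ≠ y)
    (q : Matrix ι ι R →ₗ[R] Matrix ι ι R →ₗ[R] Matrix ι ι R)
    (hq : ∀ X p r, p ≠ r → (q X X * X - X * q X X) p r = 0) :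
    ∃ (z : R) (μ : Matrix ι ι R →ₗ[R] R),
      ∀ X p r, p ≠ r → (q X X - z • (X * X) - μ X • X) p r = 0 := by
  obtain ⟨z, μ, h⟩ := (isCommutingFamily_of_offDiag q hq).exists_coeffs h2 h3
  let μ' : Matrix ι ι R →ₗ[R] R := (stdBasis R ι ι).constr R (fun x => μ x.1 x.2)
  have hμ' : ∀ i j, μ' (single i j 1) = μ i j := fun i j => by
    rw [← stdBasis_eq_single, Module.Basis.constr_basis]
  refine ⟨z, μ', fun X p r hpr => ?_⟩
  set d := entryForm (q - properForm z μ') p r with hd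
  -- The coefficients describe only the symmetrised form, so `2 d(X, X) = 0` is what bilinearity
  -- gives.
  have hsymm : d + d.flip = 0 := by
    refine (stdBasis R ι ι).ext fun x => (stdBasis R ι ι).ext fun y => ?_
    obtain ⟨i, j⟩ := x
    obtain ⟨k, l⟩ := y
    have := h i j k l p r hpr
    rw [stdBasis_eq_single, stdBasis_eq_single]
    simp only [LinearMap.add_apply, LinearMap.flip_apply, hd, entryForm_apply, LinearMap.sub_apply,
      properForm_apply, hμ', sub_apply, add_apply, smul_apply, smul_eq_mul,
      LinearMap.zero_apply] at this ⊢
    have hm : ∀ i j k l : ι, (single i j (1 : R) * single k l (1 : R) : Matrix ι ι R) p r =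
        if j = k ∧ p = i ∧ r = l then 1 else 0 := by
      intro i j k l
      by_cases hjk : j = k
      · subst hjk
        simp [single_apply, eq_comm (a := p), eq_comm (a := r)]
      · simp [hjk]
    rw [hm, hm, single_apply, single_apply]
    simp only [eq_comm (a := p), eq_comm (a := r), mul_add, mul_boole] at this ⊢
    linear_combination this
  have := congr($hsymm X X)
  simp only [LinearMap.add_apply, LinearMap.flip_apply, LinearMap.zero_apply] at this
  have h0 : d X X = 0 := h2 _ (by linear_combination this)
  simpa [hd, sub_sub] using h0

/-- A quadratic form vanishing on the kernel of a surjective linear form is divisible by it. -/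
theorem _root_.LinearMap.exists_apply_self_eq_mul {R M : Type*} [CommRing R]
    [AddCommGroup M] [Module R M]
    (f : M →ₗ[R] M →ₗ[R] R) (l : M →ₗ[R] R) {x₀ : M} (hx₀ : l x₀ = 1)
    (h : ∀ x, l x = 0 → f x x = 0) : ∃ g : M →ₗ[R] R, ∀ x, f x x = l x * g x := by
  refine ⟨f x₀ + f.flip x₀ - f x₀ x₀ • l, fun x => ?_⟩
  have := h (x - l x • x₀) (by simp [hx₀])
  simp only [map_sub, map_smul, LinearMap.sub_apply, LinearMap.smul_apply, smul_eq_mul,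
    LinearMap.add_apply, LinearMap.flip_apply] at this ⊢
  linear_combination this

/-- No `z` is needed: by Cayley–Hamilton, `X²` is a linear form times `X` plus a scalar. The only
equation is `(q_uu - q_vv) X_uv = (X_uu - X_vv) q_uv`, from which `X_uv` divides `q_uv`. The
quotients for `(u, v)` and `(v, u)` agree because both compute `q_uu - q_vv`. -/
theorem exists_offDiag_of_two [IsDomain R] (h2 : ∀ r : R, 2 * r = 0 → r = 0)
    {u v : ι} (huv : u ≠ v) (h : ∀ i, i = u ∨ i = v)
    (q : Matrix ι ι R →ₗ[R] Matrix ι ι R →ₗ[R] Matrix ι ι R)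
    (hq : ∀ X p r, p ≠ r → (q X X * X - X * q X X) p r = 0) :
    ∃ (μ : Matrix ι ι R →ₗ[R] R), ∀ X p r, p ≠ r → (q X X - μ X • X) p r = 0 := by
  have key : ∀ u v : ι, u ≠ v → (∀ i, i = u ∨ i = v) →
      ∃ g : Matrix ι ι R →ₗ[R] R, ∀ X, q X X u v = X u v * g X ∧
        q X X u u - q X X v v = (X u u - X v v) * g X := by
    intro u v huv h
    have huniv : (Finset.univ : Finset ι) = {u, v} := by ext i; simp [h i]
    have E : ∀ X, (q X X u u - q X X v v) * X u v = (X u u - X v v) * q X X u v := by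
      intro X
      have := hq X u v huv
      rw [sub_apply, mul_apply, mul_apply, huniv, Finset.sum_pair huv, Finset.sum_pair huv] at this
      linear_combination this
    -- Projection onto the hyperplane `X_uv = 0`, where the equation becomes `(X_uu - X_vv) q_uv =
    -- 0`.
    let π : Matrix ι ι R →ₗ[R] Matrix ι ι R :=
      LinearMap.id - (entryLinearMap R R u v).smulRight (single u v 1)
    have hπ : ∀ X, π X u v = 0 := fun X => by simp [π]
    have hz : ∀ X : Matrix ι ι R, X u v = 0 → q X X u v = 0 := by
      intro X hX
      have := LinearMap.apply_self_eq_zero_of_mul h2 ((entryForm q u v).compl₁₂ π π)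
        ((entryLinearMap R R u u - entryLinearMap R R v v) ∘ₗ π) (x₀ := single u u 1)
        (by simp [π, huv]) (fun Y => by
          have := E (π Y)
          rw [hπ, mul_zero] at this
          simp only [LinearMap.compl₁₂_apply, entryForm_apply, LinearMap.comp_apply,
            LinearMap.sub_apply, entryLinearMap_apply]
          linear_combination -this) X
      have hX' : π X = X := by simp [π, hX]
      simpa [hX'] using this
    obtain ⟨g, hg⟩ := LinearMap.exists_apply_self_eq_mul (entryForm q u v)
      (entryLinearMap R R u v) (x₀ := single u v 1) (by simp) (fun X hX => hz X hX)
    simp only [entryForm_apply, entryLinearMap_apply] at hg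
    refine ⟨g, fun X => ⟨hg X, ?_⟩⟩
    have := LinearMap.apply_self_eq_zero_of_mul h2 (entryForm q u u - entryForm q v v -
      (LinearMap.mul R R).compl₁₂ (entryLinearMap R R u u - entryLinearMap R R v v) g)
      (entryLinearMap R R u v) (x₀ := single u v 1) (by simp) (fun Y => by
        simp only [LinearMap.sub_apply, entryForm_apply, LinearMap.compl₁₂_apply,
          entryLinearMap_apply, LinearMap.mul_apply']
        linear_combination E Y + (Y u u - Y v v) * hg Y) X
    simp only [LinearMap.sub_apply, entryForm_apply, LinearMap.compl₁₂_apply,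
      entryLinearMap_apply, LinearMap.mul_apply'] at this
    exact sub_eq_zero.1 this
  obtain ⟨g, hg⟩ := key u v huv h
  obtain ⟨g', hg'⟩ := key v u huv.symm (fun i => (h i).symm)
  have hne : ∀ X : Matrix ι ι R, X u u - X v v ≠ 0 → g X = g' X := by
    intro X hX
    apply mul_left_cancel₀ hX
    linear_combination - (hg X).2 - (hg' X).2
  have hE : (single u u 1 : Matrix ι ι R) u u - (single u u 1 : Matrix ι ι R) v v = 1 := by
    simp [huv]
  have hgg : ∀ X, g X = g' X := by
    intro X
    by_cases hX : X u u - X v v = 0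
    · have h₁ := hne (single u u 1) (by rw [hE]; exact one_ne_zero)
      have h₂ := hne (X + single u u 1) (by
        rw [add_apply, add_apply, add_sub_add_comm, hX, zero_add, hE]; exact one_ne_zero)
      rw [map_add, map_add, h₁] at h₂
      exact add_right_cancel h₂
    · exact hne X hX
  refine ⟨g, fun X p r hpr => ?_⟩
  have h₁ := (hg X).1
  have h₂ := (hg' X).1
  rw [← hgg] at h₂
  rw [sub_apply, smul_apply, smul_eq_mul]
  obtain rfl | rfl := h p <;> obtain rfl | rfl := h r
  · exact (hpr rfl).elim
  · rw [h₁]; ring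
  · rw [h₂]; ring
  · exact (hpr rfl).elim

/-- Traces of bilinear maps on a matrix ring over a domain that are centralizing are proper. -/
theorem proper_of_centralizing [IsDomain R] (h2 : ∀ r : R, 2 * r = 0 → r = 0)
    (q : Matrix ι ι R →ₗ[R] Matrix ι ι R →ₗ[R] Matrix ι ι R)
    (hq : ∀ X p r, p ≠ r → (q X X * X - X * q X X) p r = 0) :
    ∃ (z : R) (μ : Matrix ι ι R →ₗ[R] R) (ν : Matrix ι ι R →ₗ[R] Matrix ι ι R →ₗ[R] R),
      ∀ X, q X X = z • (X * X) + μ X • X + ν X X • (1 : Matrix ι ι R) := by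
  have key : ∃ (z : R) (μ : Matrix ι ι R →ₗ[R] R),
      ∀ X p r, p ≠ r → (q X X - z • (X * X) - μ X • X) p r = 0 := by
    by_cases h3 : ∀ x y : ι, ∃ w, w ≠ x ∧ w ≠ y
    · exact exists_offDiag_of_three h2 h3 q hq
    push Not at h3
    obtain ⟨u, v, huv⟩ := h3
    by_cases h : u = v
    · subst h
      have hu : ∀ w, w = u := fun w => by_contra fun hw => hw (huv w hw)
      exact ⟨0, 0, fun X p r hpr => absurd ((hu p).trans (hu r).symm) hpr⟩
    · obtain ⟨μ, hμ⟩ := exists_offDiag_of_two h2 h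
        (fun i => or_iff_not_imp_left.2 (huv i)) q hq
      exact ⟨0, μ, by simpa using hμ⟩
  obtain ⟨z, μ, h⟩ := key
  obtain ⟨ν, hν⟩ := proper_of_offDiag h2 q hq z μ h
  exact ⟨z, μ, ν, hν⟩

end Matrix

/-! ### Determinants attached to an idempotent matrix -/

namespace Matrix

variable {ι R : Type*} [Fintype ι] [DecidableEq ι] [CommRing R]

/-- The matrix with rows from `P` over `J` and from `1 - P` elsewhere. -/
def mixRows (P : Matrix ι ι R) (J : Finset ι) : Matrix ι ι R := of (J.piecewise P (1 - P : Matrix ι ι R))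

/-- Expansion of `det (P + (1 - P))` by multilinearity in the rows. -/
theorem sum_det_mixRows (P : Matrix ι ι R) : ∑ J, (mixRows P J).det = 1 := by
  have h := (detRowAlternating (R := R) (n := ι)).toMultilinearMap.map_add_univ P
    (1 - P : Matrix ι ι R)
  have h1 : P + (1 - P) = 1 := by abel
  exact h.symm.trans ((congrArg det h1).trans det_one)

theorem mixRows_mul {P : Matrix ι ι R} (hP : P * P = P) (J : Finset ι) :
    mixRows P J * P = diagonal (fun i => if i ∈ J then 1 else 0) * mixRows P J := by
  have h0 : (1 - P) * P = 0 := by rw [sub_mul, one_mul, hP, sub_self]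
  ext i j
  have e1 := congr($hP i j)
  have e0 := congr($h0 i j)
  rw [mul_apply] at e1 e0
  have hrow : ∀ k, mixRows P J i k = if i ∈ J then P i k else (1 - P) i k := fun k => by
    simp only [mixRows, of_apply, Finset.piecewise]
    split_ifs <;> rfl
  rw [mul_apply, diagonal_mul]
  by_cases hi : i ∈ J
  · simpa only [hrow, if_pos hi, one_mul] using e1
  · simpa only [hrow, if_neg hi, zero_mul, zero_apply] using e0

end Matrix

/-! ### From corners to matrix rings, and gluing -/

section Frames

variable {R B : Type*} [CommRing R] [NonUnitalRing B] [Module R B]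

/-- A presentation of `B` as the corner `P M_n(R) P`, for an idempotent matrix `P`. -/
structure CornerPresentation {ι : Type*} [Fintype ι] [DecidableEq ι] (P : Matrix ι ι R)
    (φ : B →ₗ[R] Matrix ι ι R) (ψ : Matrix ι ι R →ₗ[R] B) : Prop where
  idem : P * P = P
  left_inv : ∀ b, ψ (φ b) = b
  right_inv : ∀ X, φ (ψ X) = P * X * P
  mul : ∀ X Y, ψ X * ψ Y = ψ (X * P * Y)

/-- An isomorphism of `B` with a matrix ring, up to powers of the scalar `s`. -/
structure MatrixFrame {ι : Type*} [Fintype ι] [DecidableEq ι] (s : R)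
    (c : B →ₗ[R] Matrix ι ι R) (f : Matrix ι ι R →ₗ[R] B) : Prop where
  left_inv : ∀ b, f (c b) = s ^ 2 • b
  right_inv : ∀ X, c (f X) = s ^ 2 • X
  mul : ∀ X Y, f X * f Y = s • f (X * Y)

open Matrix in
-- Since `M P = D M`, conjugation by `M` would carry the corner of `P` to that of the diagonal
-- idempotent `D`, which is the ring of `J × J` matrices. The adjugate replaces the inverse, at the
-- cost of powers of `s = det M`.
theorem CornerPresentation.exists_matrixFrame {ι : Type*} [Fintype ι] [DecidableEq ι]
    {P : Matrix ι ι R} {φ : B →ₗ[R] Matrix ι ι R} {ψ : Matrix ι ι R →ₗ[R] B}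
    (h : CornerPresentation P φ ψ) (J : Finset ι) :
    ∃ (c : B →ₗ[R] Matrix J J R) (f : Matrix J J R →ₗ[R] B),
      MatrixFrame (mixRows P J).det c f := by
  set M := mixRows P J with hM
  set s := M.det with hs
  set A := M.adjugate with hA
  set D : Matrix ι ι R := diagonal (fun i => if i ∈ J then 1 else 0) with hD
  let E : Matrix ι J R := (1 : Matrix ι ι R).submatrix id (↑)
  have hEE : Eᵀ * E = 1 := by
    ext ⟨i, hi⟩ ⟨j, hj⟩
    simp [E, Matrix.mul_apply, Matrix.one_apply]
  have hEE' : E * Eᵀ = D := by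
    ext i j
    rw [Matrix.mul_apply, hD, diagonal_apply]
    by_cases hi : i ∈ J
    · rw [Finset.sum_eq_single ⟨i, hi⟩]
      · simp [E, Matrix.one_apply, eq_comm (a := j), hi]
      · rintro ⟨b, hb⟩ - hne
        have : i ≠ b := fun hib => hne (by simp [hib])
        simp [E, Matrix.one_apply, this]
      · simp
    · rw [Finset.sum_eq_zero]
      · simp [hi]
      · rintro ⟨b, hb⟩ -
        have : i ≠ b := fun hib => hi (hib ▸ hb)
        simp [E, Matrix.one_apply, this]
  have hMP : M * P = D * M := mixRows_mul h.idem J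
  have hMA : M * A = s • 1 := mul_adjugate M
  have hAM : A * M = s • 1 := adjugate_mul M
  have hMPA : M * P * A = s • D := by rw [hMP, Matrix.mul_assoc, hMA, Matrix.mul_smul, Matrix.mul_one]
  have hADM : A * D * M = s • P := by
    rw [Matrix.mul_assoc, ← hMP, ← Matrix.mul_assoc, hAM, Matrix.smul_mul, Matrix.one_mul]
  have hDE : Eᵀ * D * E = 1 := by
    rw [← hEE', ← Matrix.mul_assoc, hEE, Matrix.one_mul, hEE]
  have hkey : Eᵀ * (M * P * A) * E = s • 1 := by
    rw [hMPA, Matrix.mul_smul, Matrix.smul_mul, hDE]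
  have hφ : ∀ b, P * φ b * P = φ b := fun b => by rw [← h.right_inv, h.left_inv]
  let c : B →ₗ[R] Matrix J J R :=
    { toFun := fun b => Eᵀ * M * φ b * (A * E)
      map_add' := fun x y => by rw [map_add, Matrix.mul_add, Matrix.add_mul]
      map_smul' := fun r x => by simp }
  let f : Matrix J J R →ₗ[R] B :=
    { toFun := fun X => ψ (A * E * X * (Eᵀ * M))
      map_add' := fun x y => by rw [Matrix.mul_add, Matrix.add_mul, map_add]
      map_smul' := fun r x => by simp }
  have hc : ∀ b, c b = Eᵀ * M * φ b * (A * E) := fun _ => rfl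
  have hf : ∀ X, f X = ψ (A * E * X * (Eᵀ * M)) := fun _ => rfl
  refine ⟨c, f, fun b => ?_, fun X => ?_, fun X Y => ?_⟩
  · have : A * E * (Eᵀ * M * φ b * (A * E)) * (Eᵀ * M) =
        (A * (E * Eᵀ) * M) * φ b * (A * (E * Eᵀ) * M) := by simp only [Matrix.mul_assoc]
    rw [hc, hf, this, hEE', hADM]
    simp only [Matrix.smul_mul, Matrix.mul_smul, map_smul, hφ, h.left_inv]
    rw [smul_smul, sq]
  · have : Eᵀ * M * (P * (A * E * X * (Eᵀ * M)) * P) * (A * E) =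
        (Eᵀ * (M * P * A) * E) * X * (Eᵀ * (M * P * A) * E) := by simp only [Matrix.mul_assoc]
    rw [hf, hc, h.right_inv, this, hkey]
    simp only [Matrix.smul_mul, Matrix.mul_smul, Matrix.one_mul, Matrix.mul_one]
    rw [smul_smul, sq]
  · have : A * E * X * (Eᵀ * M) * P * (A * E * Y * (Eᵀ * M)) =
        A * E * X * (Eᵀ * (M * P * A) * E) * Y * (Eᵀ * M) := by simp only [Matrix.mul_assoc]
    rw [hf, hf, h.mul, this, hkey, hf]
    simp only [Matrix.smul_mul, Matrix.mul_smul, map_smul, Matrix.mul_one, Matrix.mul_assoc]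

variable [IsScalarTower R B B] [SMulCommClass R B B]

/-- The scalars `r` for which `r q(a, a)` has a proper form with coefficients in `R e`. -/
def properIdeal (e : B) (q : B →ₗ[R] B →ₗ[R] B) : Ideal R where
  carrier := {r | ∃ (z : R) (μ : B →ₗ[R] R) (ν : B →ₗ[R] B →ₗ[R] R),
    ∀ a, r • q a a = z • (a * a) + μ a • a + ν a a • e}
  zero_mem' := ⟨0, 0, 0, fun a => by simp⟩
  add_mem' := by
    rintro r r' ⟨z, μ, ν, h⟩ ⟨z', μ', ν', h'⟩
    refine ⟨z + z', μ + μ', ν + ν', fun a => ?_⟩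
    simp only [add_smul, h, h', LinearMap.add_apply]
    abel
  smul_mem' := by
    rintro t r ⟨z, μ, ν, h⟩
    refine ⟨t * z, t • μ, t • ν, fun a => ?_⟩
    simp only [smul_eq_mul, mul_smul, h, LinearMap.smul_apply, smul_add]

theorem isProperBilinearTrace_of_one_mem {e : B} (he : ∀ x, e * x = x ∧ x * e = x)
    {q : B →ₗ[R] B →ₗ[R] B} (h : (1 : R) ∈ properIdeal e q) :
    IsProperBilinearTrace R (bilinearTrace q) := by
  obtain ⟨z, μ, ν, h⟩ := h
  have hcomm : ∀ x, Commute e x := fun x => (he x).1.trans (he x).2.symm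
  have hmem : e ∈ NonUnitalSubalgebra.center R B := by
    rw [NonUnitalSubalgebra.mem_center_iff]
    exact fun x => (hcomm x).symm
  let i : R →ₗ[R] NonUnitalSubalgebra.center R B := LinearMap.toSpanSingleton R _ ⟨e, hmem⟩
  have hi : ∀ r, (i r : B) = r • e := fun r => rfl
  refine ⟨i z, i ∘ₗ μ, ν.compr₂ i, fun a => ?_⟩
  have := h a
  rw [one_smul] at this
  simp only [bilinearTrace, LinearMap.comp_apply, LinearMap.compr₂_apply, hi, smul_mul_assoc, this,
    (he _).1]

open Matrix in
theorem MatrixFrame.pow_mem_properIdeal [IsDomain R] (h2 : ∀ r : R, 2 * r = 0 → r = 0)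
    {ι : Type*} [Fintype ι] [DecidableEq ι] {s : R} {c : B →ₗ[R] Matrix ι ι R}
    {f : Matrix ι ι R →ₗ[R] B} (h : MatrixFrame s c f) {e : B} (he : ∀ x, x * e = x)
    {q : B →ₗ[R] B →ₗ[R] B} (hq : IsCentralizing (bilinearTrace q)) :
    s ^ 8 ∈ properIdeal e q := by
  by_cases hs : s = 0
  -- A zero determinant contributes nothing; otherwise powers of `s` cancel in matrix entries.
  · rw [hs, zero_pow (by norm_num)]
    exact zero_mem _
  have hcmul : ∀ x y, s • c (x * y) = c x * c y := by
    intro x y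
    have h1 : f (c x) * f (c y) = s ^ 4 • (x * y) := by
      rw [h.left_inv, h.left_inv, smul_mul_smul_comm, ← pow_add]
    rw [h.mul] at h1
    have h3 := congrArg c h1
    rw [map_smul, map_smul, h.right_inv] at h3
    ext i j
    have h4 := congr($h3 i j)
    simp only [Matrix.smul_apply, smul_eq_mul] at h4 ⊢
    apply mul_left_cancel₀ (pow_ne_zero 3 hs)
    linear_combination -h4
  have hcentral : ∀ z ∈ Set.center B, ∀ p r, p ≠ r → c z p r = 0 := by
    intro z hz p r hpr
    have h1 : c z * (s ^ 2 • single r r 1) = (s ^ 2 • single r r 1) * c z := by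
      rw [← h.right_inv, ← hcmul, ← hcmul, (Set.mem_center_iff.1 hz).comm (f _)]
    have h3 := congr($h1 p r)
    simpa [hpr, hs] using h3
  let q' : Matrix ι ι R →ₗ[R] Matrix ι ι R →ₗ[R] Matrix ι ι R := (q.compl₁₂ f f).compr₂ c
  have hq' : ∀ X Y, q' X Y = c (q (f X) (f Y)) := fun _ _ => rfl
  obtain ⟨z, μ, ν, hp⟩ := proper_of_centralizing h2 q' (by
    intro X p r hpr
    have h1 := hcentral _ (hq (f X)) p r hpr
    have h3 : s • c (bilinearTrace q (f X) * f X - f X * bilinearTrace q (f X)) =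
        s ^ 2 • (q' X X * X - X * q' X X) := by
      rw [map_sub, smul_sub, hcmul, hcmul, h.right_inv, mul_smul_comm, smul_mul_assoc, smul_sub]
      rfl
    have h4 := congr($h3 p r)
    rw [Matrix.smul_apply, h1, smul_zero, Matrix.smul_apply, smul_eq_mul] at h4
    exact (mul_eq_zero.1 h4.symm).resolve_left (pow_ne_zero 2 hs))
  refine ⟨s ^ 5 * z, s ^ 4 • (μ ∘ₗ c), s ^ 3 • (ν.compl₁₂ c c), fun a => ?_⟩
  -- Transport to matrices and back gives `s ^ 6 • q(a, a)`. Two more factors of `s` turn `f 1` into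
  -- a multiple of `e`, whence the exponent `8`.
  have h1 := congrArg f (hp (c a))
  have hf1 : s ^ 2 • f 1 = s ^ 3 • e := by
    have : f 1 * f (c e) = s • f (c e) := by rw [h.mul, one_mul]
    rw [h.left_inv, mul_smul_comm, he, smul_smul, ← pow_succ'] at this
    exact this
  rw [hq', h.left_inv] at h1
  simp only [map_add, map_smul, LinearMap.smul_apply, h.left_inv, ← hcmul] at h1
  have h3 := congrArg (s ^ 2 • ·) h1
  simp only [smul_add, smul_comm (s ^ 2) (ν (c a) (c a)), hf1] at h3
  simp only [smul_smul] at h3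
  simp only [LinearMap.smul_apply, LinearMap.comp_apply, LinearMap.compl₁₂_apply, smul_eq_mul]
  convert h3 using 2 <;> [ring_nf; (congr 1 <;> congr 1 <;> ring); (congr 1; ring)]

theorem CornerPresentation.isProperBilinearTrace [IsDomain R] (h2 : ∀ r : R, 2 * r = 0 → r = 0)
    {ι : Type*} [Fintype ι] [DecidableEq ι] {P : Matrix ι ι R} {φ : B →ₗ[R] Matrix ι ι R}
    {ψ : Matrix ι ι R →ₗ[R] B} (h : CornerPresentation P φ ψ) {e : B}
    (he : ∀ x, e * x = x ∧ x * e = x) {q : B →ₗ[R] B →ₗ[R] B}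
    (hq : IsCentralizing (bilinearTrace q)) : IsProperBilinearTrace R (bilinearTrace q) := by
  apply isProperBilinearTrace_of_one_mem he
  rw [← Ideal.eq_top_iff_one]
  by_contra htop
  -- A maximal ideal containing every `s_J ^ 8` contains every `s_J`, hence their sum `1`.
  obtain ⟨m, hm, hle⟩ := Ideal.exists_le_maximal _ htop
  refine hm.ne_top ((Ideal.eq_top_iff_one m).2 ?_)
  rw [← Matrix.sum_det_mixRows P]
  refine Ideal.sum_mem _ fun J _ => ?_
  obtain ⟨c, f, hcf⟩ := h.exists_matrixFrame J
  exact hm.isPrime.mem_of_pow_mem 8 (hle (hcf.pow_mem_properIdeal h2 (fun x => (he x).2) hq))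

end Frames

/-! ### Unital inflated algebras as corners -/

namespace InflatedAlgebra

variable {R V : Type*} [CommRing R] [AddCommGroup V] [Module R V] (γ : V →ₗ[R] V →ₗ[R] R)

theorem mk_add_left (a a' b : V) (x : R) : mk γ (a + a') b x = mk γ a b x + mk γ a' b x := by
  simp only [mk, TensorProduct.add_tmul]; rfl

theorem mk_smul_left (r : R) (a b : V) (x : R) : mk γ (r • a) b x = r • mk γ a b x := by
  simp only [mk, ← TensorProduct.smul_tmul']; rfl

theorem mk_eq_smul (a b : V) (x : R) : mk γ a b x = x • mk γ a b 1 := by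
  change (a ⊗ₜ[R] b) ⊗ₜ[R] x = x • ((a ⊗ₜ[R] b) ⊗ₜ[R] (1 : R))
  rw [← TensorProduct.tmul_smul, smul_eq_mul, mul_one]

/-- `a ↦ a ⊗ b ⊗ x` as a linear map. -/
def mkLeft (b : V) (x : R) : V →ₗ[R] InflatedAlgebra R R V γ where
  toFun a := mk γ a b x
  map_add' a a' := mk_add_left γ a a' b x
  map_smul' r a := mk_smul_left γ r a b x

theorem exists_eq_sum (t : InflatedAlgebra R R V γ) :
    ∃ (n : ℕ) (a b : Fin n → V), t = ∑ i, mk γ (a i) (b i) 1 := by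
  obtain ⟨n, a, b, h⟩ : ∃ (n : ℕ) (a b : Fin n → V),
      TensorProduct.rid R (V ⊗[R] V) t = ∑ i, a i ⊗ₜ[R] b i := by
    generalize TensorProduct.rid R (V ⊗[R] V) t = u
    induction u with
    | zero => exact ⟨0, 0, 0, by simp⟩
    | tmul a b => exact ⟨1, fun _ => a, fun _ => b, by simp⟩
    | add u v hu hv =>
      obtain ⟨n, a, b, rfl⟩ := hu
      obtain ⟨m, c, d, rfl⟩ := hv
      exact ⟨n + m, Fin.append a c, Fin.append b d, by simp [Fin.sum_univ_add]⟩
  refine ⟨n, a, b, (TensorProduct.rid R (V ⊗[R] V)).injective ?_⟩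
  rw [h]
  refine Eq.trans ?_ (map_sum (TensorProduct.rid R (V ⊗[R] V))
    (fun i => (a i ⊗ₜ[R] b i) ⊗ₜ[R] (1 : R)) Finset.univ).symm
  simp

theorem induction_mk {p : InflatedAlgebra R R V γ → Prop} (add : ∀ x y, p x → p y → p (x + y))
    (zero : p 0) (mk_one : ∀ a b, p (mk γ a b 1))
    (x : InflatedAlgebra R R V γ) : p x := by
  obtain ⟨n, a, b, rfl⟩ := exists_eq_sum γ x
  exact Finset.sum_induction _ p add zero (fun i _ => mk_one _ _)

variable {n : ℕ} (a b : Fin n → V)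

/-- The Gram matrix of two families of vectors. -/
def gram : Matrix (Fin n) (Fin n) R := .of fun l k => γ (b l) (a k)

/-- The linear form `c ⊗ d ⊗ y ↦ γ(u, c) γ(d, v) y`. -/
noncomputable def coeffForm (u v : V) : InflatedAlgebra R R V γ →ₗ[R] R :=
  (TensorProduct.lid R R).toLinearMap ∘ₗ TensorProduct.map
    ((TensorProduct.lid R R).toLinearMap ∘ₗ TensorProduct.map (γ u) (γ.flip v)) LinearMap.id

theorem coeffForm_mk (u v c d : V) (y : R) :
    coeffForm γ u v (mk γ c d y) = γ u c * γ d v * y := by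
  change TensorProduct.lid R R (TensorProduct.map ((TensorProduct.lid R R).toLinearMap ∘ₗ
    TensorProduct.map (γ u) (γ.flip v)) LinearMap.id ((c ⊗ₜ[R] d) ⊗ₜ[R] y)) = _
  simp

/-- The matrix of an element of the inflated algebra with respect to two families of vectors. -/
noncomputable def toMatrix : InflatedAlgebra R R V γ →ₗ[R] Matrix (Fin n) (Fin n) R where
  toFun x := .of fun l k => coeffForm γ (b l) (a k) x
  map_add' x y := by ext; simp
  map_smul' r x := by ext; simp

/-- The element of the inflated algebra with given coefficients. -/
noncomputable def ofMatrix : Matrix (Fin n) (Fin n) R →ₗ[R] InflatedAlgebra R R V γ :=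
  ∑ l, ∑ k, (Matrix.entryLinearMap R R l k).smulRight (mk γ (a l) (b k) 1)

theorem ofMatrix_apply (X : Matrix (Fin n) (Fin n) R) :
    ofMatrix γ a b X = ∑ l, ∑ k, X l k • mk γ (a l) (b k) 1 := by
  simp [ofMatrix]

theorem ofMatrix_one : ofMatrix γ a b 1 = ∑ i, mk γ (a i) (b i) 1 := by
  simp [ofMatrix_apply, Matrix.one_apply]

theorem ofMatrix_mul (X Y : Matrix (Fin n) (Fin n) R) :
    ofMatrix γ a b X * ofMatrix γ a b Y = ofMatrix γ a b (X * gram γ a b * Y) := by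
  simp only [ofMatrix_apply, Finset.sum_mul, Finset.mul_sum, smul_mul_smul_comm, mk_mul_mk,
    one_mul, mul_one, Matrix.mul_apply, Finset.sum_smul, gram, Matrix.of_apply]
  rw [Finset.sum_comm]
  refine Eq.trans (Finset.sum_congr rfl fun j _ => Finset.sum_comm) ?_
  rw [Finset.sum_comm]
  refine Finset.sum_congr rfl fun l _ => Finset.sum_congr rfl fun j _ =>
    Finset.sum_congr rfl fun i _ => Finset.sum_congr rfl fun k _ => ?_
  rw [mk_eq_smul, smul_smul, mul_right_comm]

theorem toMatrix_ofMatrix (X : Matrix (Fin n) (Fin n) R) :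
    toMatrix γ a b (ofMatrix γ a b X) = gram γ a b * X * gram γ a b := by
  ext l k
  have h : toMatrix γ a b (ofMatrix γ a b X) l k =
      coeffForm γ (b l) (a k) (ofMatrix γ a b X) := rfl
  rw [h, ofMatrix_apply]
  simp only [map_sum, map_smul, coeffForm_mk, mul_one, smul_eq_mul, Matrix.mul_apply,
    Finset.sum_mul, gram, Matrix.of_apply]
  rw [Finset.sum_comm]
  refine Finset.sum_congr rfl fun i _ => Finset.sum_congr rfl fun j _ => ?_
  ring

theorem ofMatrix_toMatrix (x : InflatedAlgebra R R V γ) :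
    ofMatrix γ a b (toMatrix γ a b x) = ofMatrix γ a b 1 * x * ofMatrix γ a b 1 := by
  induction x using induction_mk with
  | add x y hx hy => rw [map_add, map_add, hx, hy, mul_add, add_mul]
  | zero => simp
  | mk_one c d =>
    have h : ∀ l k, toMatrix γ a b (mk γ c d 1) l k = coeffForm γ (b l) (a k) (mk γ c d 1) :=
      fun _ _ => rfl
    rw [ofMatrix_one]
    simp only [ofMatrix_apply, h, coeffForm_mk, Finset.sum_mul, Finset.mul_sum,
      mk_mul_mk, one_mul, mul_one]
    rw [Finset.sum_comm]
    refine Finset.sum_congr rfl fun i _ => Finset.sum_congr rfl fun j _ => ?_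
    exact (mk_eq_smul γ _ _ _).symm

/-- Both `1` and `P` are sent to `e` by `ofMatrix`; applying `toMatrix` gives `P² = P³`. Replacing
`a` by its combinations with the columns of `P` keeps `∑ aᵢ ⊗ bᵢ ⊗ 1 = e` and changes the Gram
matrix to `P²`, which is idempotent. -/
theorem cornerPresentation {a b : Fin n → V} {e : InflatedAlgebra R R V γ}
    (he : ∀ x, e * x = x ∧ x * e = x) (hab : e = ∑ i, mk γ (a i) (b i) 1) :
    ∃ a' : Fin n → V, CornerPresentation (gram γ a' b) (toMatrix γ a' b) (ofMatrix γ a' b) := by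
  set P := gram γ a b with hP
  have h1 : ofMatrix γ a b 1 = e := by rw [ofMatrix_one, hab]
  have hPe : ofMatrix γ a b P = e := by
    have := ofMatrix_mul γ a b 1 1
    rwa [one_mul, mul_one, h1, (he e).1, eq_comm] at this
  have hP3 : P * P * P = P * P := by
    have := toMatrix_ofMatrix γ a b P
    rw [hPe, ← h1, toMatrix_ofMatrix, mul_one] at this
    exact this.symm
  let a' : Fin n → V := fun k => ∑ j, P j k • a j
  have ha' : ofMatrix γ a' b 1 = e := by
    rw [← hPe, ofMatrix_one, ofMatrix_apply, Finset.sum_comm]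
    refine Finset.sum_congr rfl fun i _ => ?_
    refine (map_sum (mkLeft γ (b i) 1) _ _).trans (Finset.sum_congr rfl fun j _ => ?_)
    exact mk_smul_left γ _ _ _ _
  have hg : gram γ a' b = P * P := by
    ext l k
    simp [gram, a', P, Matrix.mul_apply, mul_comm]
  refine ⟨a', ?_, fun x => ?_, toMatrix_ofMatrix γ a' b, ofMatrix_mul γ a' b⟩
  · rw [hg, ← mul_assoc, hP3, hP3]
  · rw [ofMatrix_toMatrix, ha', (he x).1, (he x).2]

end InflatedAlgebra

theorem corollary3p24 {R V : Type*} [CommRing R] [IsDomain R]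
    (h2 : ∀ r : R, 2 * r = 0 → r = 0)
    [AddCommGroup V] [Module R V] (γ : V →ₗ[R] V →ₗ[R] R)
    (hunital : ∃ e : InflatedAlgebra R R V γ, ∀ x, e * x = x ∧ x * e = x)
    (q : InflatedAlgebra R R V γ →ₗ[R] InflatedAlgebra R R V γ →ₗ[R] InflatedAlgebra R R V γ)
    (hq : IsCentralizing (bilinearTrace q)) :
    IsProperBilinearTrace R (bilinearTrace q) := by
  obtain ⟨e, he⟩ := hunital
  obtain ⟨n, a, b, hab⟩ := InflatedAlgebra.exists_eq_sum γ e
  obtain ⟨a', h⟩ := InflatedAlgebra.cornerPresentation γ he hab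
  exact h.isProperBilinearTrace h2 he hq
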